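/- Let $N\ge 1$ and let $A$ and $B$ be independent $N\times N$ standard complex Gaussian random matrices, i.e. the $2N^2$ entries of $A$ and $B$ are jointly independent complex random variables, each with density $\frac1\pi e^{-|z|^2}$ with respect to Lebesgue measure on $\mathbb{C}$. Then $B$ is almost surely invertible, and the mean spectral density of $AB^{-1}$ is the uniform density on the Riemann sphere, whatever the value of $N$. Precisely: for an $N\times N$ complex matrix $X$ with eigenvalues $\lambda_1,\dots,\lambda_N$ (repeated according to algebraic multiplicity) let $\varrho(\cdot\,;X)=\frac1N\sum_{i=1}^N\delta_{\lambda_i}$ be its spectral measure on $\mathbb{C}$. Then $\varrho(\cdot\,;AB^{-1})$ is an (almost everywhere measurable) random measure, its mean $\mathbb{E}\,\varrho(\cdot\,;AB^{-1})$ is absolutely continuous with respect to Lebesgue measure on $\mathbb{C}$, with density $$\lambda\mapsto\frac{1}{\pi(1+|\lambda|^2)^2},$$ and the image of $\mathbb{E}\,\varrho(\cdot\,;AB^{-1})$ under the inverse stereographic projection $$z\mapsto\Big(\frac{2\,\mathrm{Re}\,z}{1+|z|^2},\ \frac{2\,\mathrm{Im}\,z}{1+|z|^2},\ \frac{|z|^2-1}{|z|^2+1}\Big)$$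 is the uniform probability measure (normalised surface area) on the unit sphere $S^2\subset\mathbb{R}^3$. -/

import Mathlib

open MeasureTheory ProbabilityTheory

open scoped ENNReal

noncomputable section

namespace SphericalEnsemble

/-- The standard complex Gaussian distribution, with density `exp (-|z|²) / π` on `ℂ`. -/
def stdComplexGaussian : Measure ℂ :=
  volume.withDensity fun z => ENNReal.ofReal (Real.exp (-‖z‖ ^ 2) / Real.pi)

/-- `A` and `B` are independent `N × N` standard complex Gaussian random matrices: each entry of `A`
and of `B` is a standard complex Gaussian, and all these `2 N²` entries are jointly independent. -/
structure AreIndepStdComplexGaussianMatrices {Ω : Type*} [MeasurableSpace Ω] {N : ℕ}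
    (A B : Ω → Matrix (Fin N) (Fin N) ℂ) (P : Measure Ω) : Prop where
  hasLaw_left : ∀ i j, HasLaw (fun ω => A ω i j) stdComplexGaussian P
  hasLaw_right : ∀ i j, HasLaw (fun ω => B ω i j) stdComplexGaussian P
  indep : iIndepFun (Sum.elim (fun (p : Fin N × Fin N) ω => A ω p.1 p.2)
    (fun (p : Fin N × Fin N) ω => B ω p.1 p.2)) P

/-- The (normalised, empirical) spectral density of an `N × N` matrix, as a measure on `ℂ`: mass
`1 / N` at each eigenvalue, eigenvalues being repeated according to algebraic multiplicity. -/
def spectralMeasure {N : ℕ} (X : Matrix (Fin N) (Fin N) ℂ) : Measure ℂ :=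
  (N : ℝ≥0∞)⁻¹ • (X.charpoly.roots.map Measure.dirac).sum

/-- The mean spectral measure `𝔼 ϱ(·; X)` of a random matrix `X`: its value on a Borel set `S` is
the expectation of `spectralMeasure (X ω) S`
(for `X` such that `ω ↦ spectralMeasure (X ω)` is almost everywhere measurable). -/
def meanSpectralMeasure {Ω : Type*} [MeasurableSpace Ω] {N : ℕ}
    (X : Ω → Matrix (Fin N) (Fin N) ℂ) (P : Measure Ω) : Measure ℂ :=
  P.bind fun ω => spectralMeasure (X ω)

/-- The unit sphere of `ℝ³`, as a model of the Riemann sphere. -/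
abbrev RiemannSphere : Type := Metric.sphere (0 : EuclideanSpace ℝ (Fin 3)) 1

/-- The embedding of `ℂ` in the Riemann sphere: inverse stereographic projection from the north
pole `(0, 0, 1)` onto the equatorial plane. -/
def toRiemannSphere (z : ℂ) : RiemannSphere :=
  ⟨!₂[2 * z.re / (1 + ‖z‖ ^ 2), 2 * z.im / (1 + ‖z‖ ^ 2), (‖z‖ ^ 2 - 1) / (1 + ‖z‖ ^ 2)], by
    have h : ‖z‖ ^ 2 = z.re ^ 2 + z.im ^ 2 := by
      rw [Complex.sq_norm, Complex.normSq_apply]; ring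
    have h0 : 1 + (z.re ^ 2 + z.im ^ 2) ≠ 0 := by positivity
    rw [mem_sphere_zero_iff_norm, EuclideanSpace.norm_eq, Real.sqrt_eq_one]
    simp only [Fin.sum_univ_three, Real.norm_eq_abs, sq_abs, h]
    simp
    field_simp
    ring⟩

/-- The uniform probability measure on the Riemann sphere: normalised surface area. -/
def uniformRiemannSphere : Measure RiemannSphere :=
  ((volume : Measure (EuclideanSpace ℝ (Fin 3))).toSphere Set.univ)⁻¹ •
    (volume : Measure (EuclideanSpace ℝ (Fin 3))).toSphere

end SphericalEnsemble

end

namespace SphericalEnsemble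

/-! The law of `(A, B)` is invariant under every unitary mixing `(A, B) ↦ (aA + bB, -b̄A + āB)` with
`|a|² + |b|² = 1`, and the quotient ignores a common scalar, so any `(a, b) ≠ 0` may be used. On `X
= AB⁻¹` the mixing acts as `(aX + b)(-b̄X + ā)⁻¹`, hence moves each eigenvalue by the rotation `z ↦
(az + b)/(-b̄z + ā)` of the Riemann sphere (`roots_charpoly_moebius`).

Take `a, b` independent standard Gaussians, independent of `(A, B)`. For fixed `z`, the map `(a, b)
↦ (az + b, ā - b̄z)` is `√(1 + |z|²)` times a real isometry, so the rotated point is distributed as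
a ratio of two independent Gaussians, whatever `z` is (`map_moebius_gaussian_prod`). That ratio has
density `1/(π(1 + |w|²)²)`. By Fubini, the mean spectral measure is this law for every `N ≥ 1`; no
joint eigenvalue density is needed.

Three points remain: measurability of the spectral measure (Lusin–Souslin), almost sure
invertibility of `B`, and the identification with surface area, by a change of variables in `ℝ³`. -/

/-! ### Gaussian pairs and the law of their ratio. -/

lemma lintegral_exp_neg_sq :
    ∫⁻ z : ℂ, ENNReal.ofReal (Real.exp (-‖z‖ ^ 2)) = ENNReal.ofReal Real.pi := by
  have h := Complex.integral_exp_neg_rpow (p := 2) (by norm_num)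
  have h2 : ∫ z : ℂ, Real.exp (-‖z‖ ^ 2) = Real.pi := by
    simpa [Real.Gamma_add_one] using h
  rw [← h2, ofReal_integral_eq_lintegral_ofReal]
  -- A non-integrable function has Bochner integral `0`, so the nonzero value already proves
  -- integrability.
  · exact Integrable.of_integral_ne_zero (by rw [h2]; exact Real.pi_ne_zero)
  · exact Filter.Eventually.of_forall fun z => (Real.exp_pos _).le

lemma lintegral_sq_mul_exp_neg_mul_sq {c : ℝ} (hc : 0 < c) :
    ∫⁻ z : ℂ, ENNReal.ofReal (‖z‖ ^ 2 * Real.exp (-c * ‖z‖ ^ 2)) =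
      ENNReal.ofReal (Real.pi / c ^ 2) := by
  have h := Complex.integral_rpow_mul_exp_neg_mul_rpow (p := 2) (q := 2) (b := c)
    (by norm_num) (by norm_num) hc
  have h2 : ∫ z : ℂ, ‖z‖ ^ 2 * Real.exp (-c * ‖z‖ ^ 2) = Real.pi / c ^ 2 := by
    have e : (-(2 + 2) / 2 : ℝ) = -(2 : ℕ) := by norm_num
    have e' : ((2 + 2) / 2 : ℝ) = 1 + 1 := by norm_num
    rw [e, e', Real.Gamma_add_one one_ne_zero, Real.Gamma_one, Real.rpow_neg hc.le,
      Real.rpow_natCast] at h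
    simp only [Real.rpow_two] at h
    rw [h]
    field_simp
  rw [← h2, ofReal_integral_eq_lintegral_ofReal]
  · refine Integrable.of_integral_ne_zero ?_
    rw [h2]
    positivity
  · exact Filter.Eventually.of_forall fun z => by positivity

instance : IsProbabilityMeasure stdComplexGaussian := by
  constructor
  rw [stdComplexGaussian, withDensity_apply _ MeasurableSet.univ, Measure.restrict_univ]
  simp_rw [ENNReal.ofReal_div_of_pos Real.pi_pos, div_eq_mul_inv]
  rw [lintegral_mul_const _ (by fun_prop), lintegral_exp_neg_sq]
  exact ENNReal.mul_inv_cancel (by simp [Real.pi_pos]) (by simp)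

lemma ae_ne_zero_gaussian : ∀ᵐ z ∂stdComplexGaussian, z ≠ 0 :=
  measure_eq_zero_iff_ae_notMem.1
    (withDensity_absolutelyContinuous _ _ (measure_singleton (0 : ℂ)))

lemma gaussian_prod_eq : stdComplexGaussian.prod stdComplexGaussian =
    (volume : Measure (ℂ × ℂ)).withDensity fun p =>
      ENNReal.ofReal (Real.exp (-(‖p.1‖ ^ 2 + ‖p.2‖ ^ 2)) / Real.pi ^ 2) := by
  unfold stdComplexGaussian
  rw [prod_withDensity (by fun_prop) (by fun_prop), Measure.volume_eq_prod]
  congr 1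
  ext p
  rw [← ENNReal.ofReal_mul (by positivity), neg_add, Real.exp_add]
  congr 1
  field_simp

/-- Real-linear maps preserving `|u|² + |v|²` preserve the law of a pair of independent standard
complex Gaussians. -/
lemma measurePreserving_gaussian_prod (L : ℂ × ℂ →ₗ[ℝ] ℂ × ℂ)
    (hL : ∀ p, ‖(L p).1‖ ^ 2 + ‖(L p).2‖ ^ 2 = ‖p.1‖ ^ 2 + ‖p.2‖ ^ 2) :
    MeasurePreserving L (stdComplexGaussian.prod stdComplexGaussian)
      (stdComplexGaussian.prod stdComplexGaussian) := by
  have hmeas : Measurable L := L.continuous_of_finiteDimensional.measurable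
  refine ⟨hmeas, ?_⟩
  have hinj : Function.Injective L := by
    rw [injective_iff_map_eq_zero]
    intro p hp
    have h := hL p
    rw [hp] at h
    simp only [Prod.fst_zero, Prod.snd_zero, norm_zero] at h
    have h1 : ‖p.1‖ = 0 := by nlinarith [sq_nonneg ‖p.1‖, sq_nonneg ‖p.2‖]
    have h2 : ‖p.2‖ = 0 := by nlinarith [sq_nonneg ‖p.1‖, sq_nonneg ‖p.2‖]
    exact Prod.ext (norm_eq_zero.1 h1) (norm_eq_zero.1 h2)
  have hdet : LinearMap.det L ≠ 0 := by
    intro h0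
    exact (LinearMap.bot_lt_ker_of_det_eq_zero h0).ne' (LinearMap.ker_eq_bot.2 hinj)
  have : (volume : Measure (ℂ × ℂ)).IsAddHaarMeasure :=
    inferInstanceAs (((volume : Measure ℂ).prod volume).IsAddHaarMeasure)
  set c := ENNReal.ofReal |(LinearMap.det L)⁻¹|
  have key : (stdComplexGaussian.prod stdComplexGaussian).map L =
      c • (stdComplexGaussian.prod stdComplexGaussian) := by
    rw [gaussian_prod_eq]
    ext S hS
    rw [Measure.map_apply hmeas hS, withDensity_apply _ (hmeas hS), Measure.smul_apply,
      withDensity_apply _ hS, ← lintegral_smul_measure, ← Measure.restrict_smul,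
      ← Measure.map_linearMap_addHaar_eq_smul_addHaar _ hdet,
      setLIntegral_map hS (by fun_prop) hmeas]
    simp_rw [hL]
  -- The Jacobian factor need not be computed: both measures in `key` come from probability
  -- measures, so total mass forces it to be `1`.
  have hc : c = 1 := by
    have h := congrArg (fun μ => μ Set.univ) key
    simp only [Measure.map_apply hmeas MeasurableSet.univ, Set.preimage_univ, measure_univ,
      Measure.smul_apply, smul_eq_mul, mul_one] at h
    exact h.symm
  rw [key, hc, one_smul]

/-- The uniform measure of the Riemann sphere in the stereographic coordinate; it is the law of the
ratio of two independent standard complex Gaussians. -/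
noncomputable def sphericalMeasure : Measure ℂ :=
  volume.withDensity fun z : ℂ => ENNReal.ofReal (1 / (Real.pi * (1 + ‖z‖ ^ 2) ^ 2))

/-- The real determinant of multiplication by `v` is the norm of `v` from `ℂ` to `ℝ`, that is
`|v|²`. -/
lemma map_mul_left_volume {v : ℂ} (hv : v ≠ 0) :
    ENNReal.ofReal (‖v‖ ^ 2) • (volume : Measure ℂ).map (fun w => v * w) = volume := by
  have hdet : LinearMap.det (LinearMap.mulLeft ℝ v) = ‖v‖ ^ 2 := by
    have := Algebra.norm_complex_apply v
    rw [Algebra.norm_apply] at this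
    rw [← Complex.normSq_eq_norm_sq, ← this]
    rfl
  have hv' : 0 < ‖v‖ ^ 2 := by positivity
  have h := Measure.map_linearMap_addHaar_eq_smul_addHaar (volume : Measure ℂ)
    (f := LinearMap.mulLeft ℝ v) (by rw [hdet]; exact hv'.ne')
  have h' : (volume : Measure ℂ).map (fun w => v * w) =
      ENNReal.ofReal |(LinearMap.det (LinearMap.mulLeft ℝ v))⁻¹| • volume := h
  rw [h', hdet, smul_smul, ← ENNReal.ofReal_mul hv'.le, abs_of_pos (by positivity),
    mul_inv_cancel₀ hv'.ne', ENNReal.ofReal_one, one_smul]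

lemma gaussian_div_preimage {v : ℂ} (hv : v ≠ 0) {S : Set ℂ} (hS : MeasurableSet S) :
    stdComplexGaussian ((fun u => u / v) ⁻¹' S) =
      ∫⁻ w in S, ENNReal.ofReal (‖v‖ ^ 2 * (Real.exp (-(‖v‖ ^ 2 * ‖w‖ ^ 2)) / Real.pi)) := by
  have hm : Measurable fun u : ℂ => u / v := by fun_prop
  rw [stdComplexGaussian, withDensity_apply _ (hm hS)]
  nth_rewrite 1 [← map_mul_left_volume hv]
  rw [Measure.restrict_smul, lintegral_smul_measure,
    setLIntegral_map (hm hS) (by fun_prop) (by fun_prop), smul_eq_mul,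
    ← lintegral_const_mul _ (by fun_prop)]
  have : (fun w => v * w) ⁻¹' ((fun u => u / v) ⁻¹' S) = S := by
    ext w
    simp [mul_div_cancel_left₀ w hv]
  rw [this]
  refine lintegral_congr fun w => ?_
  rw [← ENNReal.ofReal_mul (by positivity), norm_mul, mul_pow]

/-- Conditionally on the denominator `v`, the substitution `u = vw` gives the density of the ratio
at `w`; integrating over `v` leaves the second moment of a Gaussian weight with parameter `1 +
|w|²`. -/
lemma map_div_gaussian_prod :
    (stdComplexGaussian.prod stdComplexGaussian).map (fun p => p.1 / p.2) = sphericalMeasure := by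
  have hm : Measurable fun p : ℂ × ℂ => p.1 / p.2 := by fun_prop
  ext S hS
  rw [Measure.map_apply hm hS, Measure.prod_apply_symm (hm hS), sphericalMeasure,
    withDensity_apply _ hS]
  have h1 : ∫⁻ v : ℂ, stdComplexGaussian ((fun u => (u, v)) ⁻¹' ((fun p : ℂ × ℂ => p.1 / p.2) ⁻¹' S))
        ∂stdComplexGaussian = ∫⁻ v : ℂ, (∫⁻ w in S,
        ENNReal.ofReal (‖v‖ ^ 2 * (Real.exp (-(‖v‖ ^ 2 * ‖w‖ ^ 2)) / Real.pi)))
          ∂stdComplexGaussian := by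
    refine lintegral_congr_ae ?_
    filter_upwards [ae_ne_zero_gaussian] with v hv
    exact gaussian_div_preimage hv hS
  rw [h1, lintegral_lintegral_swap (by fun_prop)]
  refine lintegral_congr fun w => ?_
  rw [stdComplexGaussian, lintegral_withDensity_eq_lintegral_mul _ (by fun_prop) (by fun_prop)]
  have hc : 0 < 1 + ‖w‖ ^ 2 := by positivity
  calc _ = ∫⁻ v : ℂ, ENNReal.ofReal (1 / Real.pi ^ 2) *
        ENNReal.ofReal (‖v‖ ^ 2 * Real.exp (-(1 + ‖w‖ ^ 2) * ‖v‖ ^ 2)) := by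
        refine lintegral_congr fun v => ?_
        rw [Pi.mul_apply, ← ENNReal.ofReal_mul (by positivity), ← ENNReal.ofReal_mul (by positivity)]
        have : -(1 + ‖w‖ ^ 2) * ‖v‖ ^ 2 = -‖v‖ ^ 2 + -(‖v‖ ^ 2 * ‖w‖ ^ 2) := by ring
        rw [this, Real.exp_add]
        congr 1
        field_simp
    _ = _ := by
        rw [lintegral_const_mul _ (by fun_prop), lintegral_sq_mul_exp_neg_mul_sq hc,
          ← ENNReal.ofReal_mul (by positivity)]
        congr 1
        field_simp

instance : IsProbabilityMeasure sphericalMeasure := by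
  rw [← map_div_gaussian_prod]
  exact Measure.isProbabilityMeasure_map (by fun_prop)

/-! ### Random rotations of the sphere. -/

/-- The linear map `(u, v) ↦ (a u + b v, -b̄ u + ā v)`, unitary up to a scalar. -/
noncomputable def unitaryMap (a b : ℂ) : ℂ × ℂ →ₗ[ℝ] ℂ × ℂ where
  toFun p := (a * p.1 + b * p.2, -(starRingEnd ℂ b) * p.1 + starRingEnd ℂ a * p.2)
  map_add' p q := by ext1 <;> simp <;> ring
  map_smul' r p := by ext1 <;> simp <;> ring

/-- The linear map `(a, b) ↦ (a z + b, ā - b̄ z)`, unitary up to a scalar. -/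
noncomputable def coeffMap (z : ℂ) : ℂ × ℂ →ₗ[ℝ] ℂ × ℂ where
  toFun p := (p.1 * z + p.2, -(starRingEnd ℂ p.2) * z + starRingEnd ℂ p.1)
  map_add' p q := by ext1 <;> simp <;> ring
  map_smul' r p := by ext1 <;> simp <;> ring

lemma measurePreserving_inv_smul (L : ℂ × ℂ →ₗ[ℝ] ℂ × ℂ) {c : ℝ} (hc : 0 < c)
    (hL : ∀ p, ‖(L p).1‖ ^ 2 + ‖(L p).2‖ ^ 2 = c * (‖p.1‖ ^ 2 + ‖p.2‖ ^ 2)) :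
    MeasurePreserving ((Real.sqrt c)⁻¹ • L) (stdComplexGaussian.prod stdComplexGaussian)
      (stdComplexGaussian.prod stdComplexGaussian) := by
  refine measurePreserving_gaussian_prod _ fun p => ?_
  simp only [LinearMap.smul_apply, Prod.smul_fst, Prod.smul_snd, norm_smul, mul_pow, norm_inv,
    Real.norm_eq_abs, inv_pow, sq_abs, Real.sq_sqrt hc.le]
  rw [← mul_add, hL]
  field_simp

lemma unitaryMap_norm (a b : ℂ) (p : ℂ × ℂ) :
    ‖(unitaryMap a b p).1‖ ^ 2 + ‖(unitaryMap a b p).2‖ ^ 2 =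
      (‖a‖ ^ 2 + ‖b‖ ^ 2) * (‖p.1‖ ^ 2 + ‖p.2‖ ^ 2) := by
  simp only [unitaryMap, LinearMap.coe_mk, AddHom.coe_mk, Complex.sq_norm, Complex.normSq_apply,
    Complex.add_re, Complex.add_im, Complex.mul_re, Complex.mul_im, Complex.neg_re, Complex.neg_im,
    Complex.conj_re, Complex.conj_im]
  ring

lemma coeffMap_norm (z : ℂ) (p : ℂ × ℂ) :
    ‖(coeffMap z p).1‖ ^ 2 + ‖(coeffMap z p).2‖ ^ 2 =
      (1 + ‖z‖ ^ 2) * (‖p.1‖ ^ 2 + ‖p.2‖ ^ 2) := by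
  simp only [coeffMap, LinearMap.coe_mk, AddHom.coe_mk, Complex.sq_norm, Complex.normSq_apply,
    Complex.add_re, Complex.add_im, Complex.mul_re, Complex.mul_im, Complex.neg_re, Complex.neg_im,
    Complex.conj_re, Complex.conj_im]
  ring

/-- A fixed point of the plane is sent by a random Möbius rotation to a point with law
`sphericalMeasure`. -/
lemma map_moebius_gaussian_prod (z : ℂ) :
    (stdComplexGaussian.prod stdComplexGaussian).map
      (fun p => (coeffMap z p).1 / (coeffMap z p).2) = sphericalMeasure := by
  have hc : 0 < 1 + ‖z‖ ^ 2 := by positivity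
  have h := measurePreserving_inv_smul (coeffMap z) hc (coeffMap_norm z)
  have hm : Measurable fun p : ℂ × ℂ => p.1 / p.2 := by fun_prop
  rw [← map_div_gaussian_prod]
  conv_rhs => rw [← h.map_eq, Measure.map_map hm h.measurable]
  congr 1
  ext1 p
  have hs : ((Real.sqrt (1 + ‖z‖ ^ 2) : ℝ) : ℂ) ≠ 0 := by
    exact_mod_cast (Real.sqrt_pos.2 hc).ne'
  simp only [Function.comp_apply, LinearMap.smul_apply, Prod.smul_fst, Prod.smul_snd,
    Complex.real_smul, Complex.ofReal_inv]
  field_simp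

/-- After normalisation the second coordinate is again a standard Gaussian, which has no atom at
`0`. -/
lemma ae_coeffMap_snd_ne_zero (z : ℂ) :
    ∀ᵐ p ∂stdComplexGaussian.prod stdComplexGaussian, (coeffMap z p).2 ≠ 0 := by
  have hc : 0 < 1 + ‖z‖ ^ 2 := by positivity
  have h := measurePreserving_inv_smul (coeffMap z) hc (coeffMap_norm z)
  have h0 : ∀ᵐ p ∂stdComplexGaussian.prod stdComplexGaussian, p.2 ≠ 0 :=
    Measure.quasiMeasurePreserving_snd.ae ae_ne_zero_gaussian
  filter_upwards [h.quasiMeasurePreserving.ae h0] with p hp h1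
  apply hp
  simp [h1]

lemma ae_ne_zero_gaussian_prod :
    ∀ᵐ p ∂stdComplexGaussian.prod stdComplexGaussian, 0 < ‖p.1‖ ^ 2 + ‖p.2‖ ^ 2 := by
  filter_upwards [ae_coeffMap_snd_ne_zero 0] with p hp
  have : p.1 ≠ 0 := by simpa [coeffMap] using hp
  positivity

/-! ### Eigenvalues under Möbius maps, and measurability of the spectrum. -/

section Spectrum

open Polynomial

variable {N : ℕ}

lemma card_roots_charpoly (X : Matrix (Fin N) (Fin N) ℂ) : X.charpoly.roots.card = N := by
  rw [← (IsAlgClosed.splits X.charpoly).natDegree_eq_card_roots, X.charpoly_natDegree_eq_dim,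
    Fintype.card_fin]

/-- This homogeneous form of the characteristic polynomial includes `t = 0`, so that Möbius maps
need no case distinction on their coefficients. -/
lemma det_smul_one_sub_smul (X : Matrix (Fin N) (Fin N) ℂ) (s t : ℂ) :
    (s • (1 : Matrix (Fin N) (Fin N) ℂ) - t • X).det =
      (X.charpoly.roots.map fun z => s - t * z).prod := by
  have hcard := card_roots_charpoly X
  rcases eq_or_ne t 0 with rfl | ht
  · simp [hcard]
  · have h1 : s • (1 : Matrix (Fin N) (Fin N) ℂ) - t • X =
        t • (Matrix.scalar (Fin N) (s / t) - X) := by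
      rw [smul_sub, Matrix.scalar_apply, ← Matrix.smul_one_eq_diagonal, smul_smul,
        mul_div_cancel₀ _ ht]
    have h2 : (X.charpoly.roots.map fun _ => t).prod = t ^ N := by simp [hcard]
    rw [h1, Matrix.det_smul, ← Matrix.eval_charpoly, Fintype.card_fin,
      (IsAlgClosed.splits X.charpoly).eval_eq_prod_roots_of_monic X.charpoly_monic, ← h2,
      ← Multiset.prod_map_mul]
    refine congrArg Multiset.prod (Multiset.map_congr rfl fun z _ => ?_)
    rw [mul_sub, mul_div_cancel₀ _ ht]

/-- Eigenvalues of a Möbius transform of a matrix. -/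
lemma roots_charpoly_moebius (X : Matrix (Fin N) (Fin N) ℂ) (a b c d : ℂ)
    (h : ∀ z ∈ X.charpoly.roots, c * z + d ≠ 0) :
    ((a • X + b • 1) * (c • X + d • 1)⁻¹).charpoly.roots =
      X.charpoly.roots.map fun z => (a * z + b) / (c * z + d) := by
  set R := X.charpoly.roots with hR
  set D := c • X + d • (1 : Matrix (Fin N) (Fin N) ℂ) with hD
  have hdetD : D.det = (R.map fun z => c * z + d).prod := by
    have := det_smul_one_sub_smul X d (-c)
    rw [neg_smul, sub_neg_eq_add, add_comm] at this
    rw [hD, this]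
    exact congrArg Multiset.prod (Multiset.map_congr rfl fun z _ => by ring)
  have hne : D.det ≠ 0 := by
    rw [hdetD]
    refine Multiset.prod_ne_zero fun h0 => ?_
    obtain ⟨z, hz, hz0⟩ := Multiset.mem_map.1 h0
    exact h z hz hz0
  have hDu : IsUnit D.det := hne.isUnit
  suffices hp : ((a • X + b • 1) * D⁻¹).charpoly =
      ((R.map fun z => (a * z + b) / (c * z + d)).map fun w => Polynomial.X - C w).prod by
    rw [hp, roots_multiset_prod_X_sub_C]
  refine Polynomial.funext fun w => mul_right_cancel₀ hne ?_
  -- Multiplying by `D` clears the inverse and leaves a pencil linear in `X`, whose determinant is a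
  -- product over the eigenvalues.
  have h1 : (Matrix.scalar (Fin N) w - (a • X + b • 1) * D⁻¹) * D =
      (w * d - b) • (1 : Matrix (Fin N) (Fin N) ℂ) - (a - w * c) • X := by
    rw [sub_mul, Matrix.nonsing_inv_mul_cancel_right _ _ hDu, hD, Matrix.scalar_apply,
      ← Matrix.smul_one_eq_diagonal, smul_mul_assoc, one_mul]
    module
  rw [Matrix.eval_charpoly, ← Matrix.det_mul, h1, det_smul_one_sub_smul, hdetD,
    Polynomial.eval_multiset_prod, Multiset.map_map, Multiset.map_map, ← Multiset.prod_map_mul]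
  refine congrArg Multiset.prod (Multiset.map_congr rfl fun z hz => ?_)
  have := h z hz
  simp only [Function.comp_apply, eval_sub, eval_X, eval_C]
  field_simp
  ring

lemma spectralMeasure_apply (X : Matrix (Fin N) (Fin N) ℂ) {S : Set ℂ} (hS : MeasurableSet S) :
    spectralMeasure X S =
      (N : ℝ≥0∞)⁻¹ * (X.charpoly.roots.map fun z => S.indicator 1 z).sum := by
  rw [spectralMeasure, Measure.smul_apply, smul_eq_mul]
  congr 1
  induction X.charpoly.roots using Multiset.induction with
  | empty => simp
  | cons z s ih => simp [ih, Measure.dirac_apply' _ hS]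

/-- The monic polynomial of degree `N` with given coefficients. -/
noncomputable def monicOfCoeffs (y : Fin N → ℂ) : ℂ[X] := X ^ N + ∑ i, C (y i) * X ^ (i : ℕ)

lemma monicOfCoeffs_coeff {p : ℂ[X]} (hp : p.Monic) (hN : p.natDegree = N) :
    monicOfCoeffs (fun i : Fin N => p.coeff i) = p := by
  conv_rhs => rw [hp.as_sum, hN]
  rw [monicOfCoeffs, Finset.sum_range]

lemma monicOfCoeffs_monic (y : Fin N → ℂ) :
    (monicOfCoeffs y).Monic ∧ (monicOfCoeffs y).natDegree = N := by
  have h := degree_sum_fin_lt y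
  have h' : (∑ i, C (y i) * X ^ (i : ℕ)).degree < (X ^ N : ℂ[X]).degree := by
    rwa [degree_X_pow]
  refine ⟨monic_X_pow_add h, natDegree_eq_of_degree_eq_some ?_⟩
  rw [monicOfCoeffs, degree_add_eq_left_of_degree_lt h', degree_X_pow]

lemma coeff_monicOfCoeffs (y : Fin N → ℂ) (i : Fin N) : (monicOfCoeffs y).coeff i = y i := by
  simp [monicOfCoeffs, coeff_X_pow, i.isLt.ne, Fin.val_inj]

lemma exists_map_univ_eq {α : Type*} (s : Multiset α) (hs : s.card = N) :
    ∃ l : Fin N → α, Finset.univ.val.map l = s := by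
  obtain ⟨L, rfl⟩ : ∃ L : List α, s = L := ⟨s.toList, s.coe_toList.symm⟩
  rw [Multiset.coe_card] at hs
  subst hs
  exact ⟨L.get, by rw [Fin.univ_val_map, List.ofFn_get]⟩

lemma continuous_charpoly_coeff (i : ℕ) :
    Continuous fun w : Fin N × Fin N → ℂ => (Matrix.of fun i j => w (i, j)).charpoly.coeff i := by
  have h : (fun w : Fin N × Fin N → ℂ => (Matrix.of fun i j => w (i, j)).charpoly.coeff i) =
      fun w => MvPolynomial.eval w ((Matrix.charpoly.univ ℂ (Fin N)).coeff i) := by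
    ext w
    exact (Matrix.charpoly.univ_coeff_eval₂Hom (n := Fin N) (RingHom.id ℂ) w i).symm
  rw [h]
  exact MvPolynomial.continuous_eval _

/-- By the Lusin–Souslin theorem, a symmetric measurable function of the roots of a monic
polynomial is a measurable function of its coefficients. -/
lemma measurable_roots_dirac :
    Measurable fun y : Fin N → ℂ => ((monicOfCoeffs y).roots.map Measure.dirac).sum := by
  let F : (Fin N → ℂ) → Fin N → ℂ := fun l i => (∏ j, (X - C (l j))).coeff i
  have hF0 : ∀ l, F l = fun i : Fin N =>
      (Matrix.of fun i j => Matrix.diagonal l i j).charpoly.coeff i := by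
    intro l
    ext i
    have : (Matrix.of fun i j => Matrix.diagonal l i j) = Matrix.diagonal l := rfl
    rw [this, Matrix.charpoly_diagonal]
  have hmon : ∀ l : Fin N → ℂ, monicOfCoeffs (F l) = ∏ j, (X - C (l j)) := fun l =>
    monicOfCoeffs_coeff (monic_prod_X_sub_C _ _) (by simp)
  have hF : Measurable F := by
    refine measurable_pi_lambda _ fun i => Continuous.measurable ?_
    simp_rw [hF0]
    refine (continuous_charpoly_coeff (N := N) i).comp
      (f := fun l : Fin N → ℂ => fun p : Fin N × Fin N => Matrix.diagonal l p.1 p.2) ?_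
    refine continuous_pi fun p => ?_
    simp only [Matrix.diagonal_apply]
    split_ifs <;> fun_prop
  have hsurj : Function.Surjective F := by
    intro y
    obtain ⟨hm, hd⟩ := monicOfCoeffs_monic y
    have hs := IsAlgClosed.splits (monicOfCoeffs y)
    obtain ⟨l, hl⟩ := exists_map_univ_eq (N := N) (monicOfCoeffs y).roots
      (by rw [← hs.natDegree_eq_card_roots, hd])
    refine ⟨l, ?_⟩
    ext i
    have : ∏ j, (X - C (l j)) = monicOfCoeffs y := by
      conv_rhs => rw [hs.eq_prod_roots_of_monic hm, ← hl, Multiset.map_map]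
      rfl
    simp only [F, this, coeff_monicOfCoeffs]
  have : (fun y : Fin N → ℂ => ((monicOfCoeffs y).roots.map Measure.dirac).sum) ∘ F =
      fun l => ∑ j, Measure.dirac (l j) := by
    ext1 l
    have hr : (∏ j, (X - C (l j))).roots = Finset.univ.val.map l := by
      rw [← roots_multiset_prod_X_sub_C (Finset.univ.val.map l), Multiset.map_map]
      rfl
    rw [Function.comp_apply, hmon, hr, Multiset.map_map]
    rfl
  intro T hT
  -- Lusin–Souslin enters here: measurability can be tested after pulling back along the surjection
  -- `F` from roots to coefficients, where the map is a plain sum of Dirac masses.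
  rw [← hF.measurableSet_preimage_iff_of_surjective hsurj, ← Set.preimage_comp, this]
  suffices h : Measurable fun l : Fin N → ℂ => ∑ j, Measure.dirac (l j) from h hT
  refine Measure.measurable_of_measurable_coe _ fun S hS => ?_
  simp only [Measure.finsetSum_apply]
  refine Finset.measurable_sum _ fun j _ => ?_
  exact (Measure.measurable_coe hS).comp (Measure.measurable_dirac.comp (measurable_pi_apply j))

lemma measurable_spectralMeasure :
    Measurable fun w : Fin N × Fin N → ℂ => spectralMeasure (Matrix.of fun i j => w (i, j)) := by
  have h : ∀ X : Matrix (Fin N) (Fin N) ℂ, spectralMeasure X = (N : ℝ≥0∞)⁻¹ •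
      ((monicOfCoeffs fun i : Fin N => X.charpoly.coeff i).roots.map Measure.dirac).sum := by
    intro X
    rw [monicOfCoeffs_coeff X.charpoly_monic (by rw [X.charpoly_natDegree_eq_dim, Fintype.card_fin]),
      spectralMeasure]
  simp_rw [h]
  have hm : Measurable fun w : Fin N × Fin N → ℂ => fun i : Fin N =>
      (Matrix.of fun i j => w (i, j)).charpoly.coeff i :=
    measurable_pi_lambda _ fun i => (continuous_charpoly_coeff (N := N) i).measurable
  refine Measure.measurable_of_measurable_coe _ fun S hS => ?_
  simp only [Measure.smul_apply, smul_eq_mul]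
  exact ((Measure.measurable_coe hS).comp (measurable_roots_dirac.comp hm)).const_mul _

end Spectrum

/-! ### Stereographic projection and surface area. -/

/-- Polar coordinates on `ℝ³`, the direction being parametrised by inverse stereographic
projection. -/
noncomputable def stereoPolar (x : Fin 3 → ℝ) : Fin 3 → ℝ :=
  ![x 2 * (2 * x 0) / (1 + (x 0 ^ 2 + x 1 ^ 2)), x 2 * (2 * x 1) / (1 + (x 0 ^ 2 + x 1 ^ 2)),
    x 2 * (x 0 ^ 2 + x 1 ^ 2 - 1) / (1 + (x 0 ^ 2 + x 1 ^ 2))]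

/-- The Jacobian matrix of `stereoPolar`. -/
noncomputable def stereoPolarJacobian (x : Fin 3 → ℝ) : Matrix (Fin 3) (Fin 3) ℝ :=
  ((1 + (x 0 ^ 2 + x 1 ^ 2)) ^ 2)⁻¹ •
  !![2 * x 2 * (1 - x 0 ^ 2 + x 1 ^ 2), - 4 * x 2 * x 0 * x 1, 2 * x 0 * (1 + (x 0 ^ 2 + x 1 ^ 2));
    - 4 * x 2 * x 0 * x 1, 2 * x 2 * (1 + x 0 ^ 2 - x 1 ^ 2), 2 * x 1 * (1 + (x 0 ^ 2 + x 1 ^ 2));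
    4 * x 2 * x 0, 4 * x 2 * x 1,
      (x 0 ^ 2 + x 1 ^ 2 - 1) * (1 + (x 0 ^ 2 + x 1 ^ 2))]

lemma det_stereoPolarJacobian (x : Fin 3 → ℝ) :
    (stereoPolarJacobian x).det = - (4 * x 2 ^ 2 / (1 + (x 0 ^ 2 + x 1 ^ 2)) ^ 2) := by
  have h0 : 1 + (x 0 ^ 2 + x 1 ^ 2) ≠ 0 := by positivity
  rw [stereoPolarJacobian, Matrix.det_smul, Matrix.det_fin_three]
  simp
  field_simp
  ring

lemma hasFDerivAt_stereoPolar (x : Fin 3 → ℝ) :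
    HasFDerivAt stereoPolar (Matrix.toLin' (stereoPolarJacobian x)).toContinuousLinearMap x := by
  have h0 : 1 + (x 0 ^ 2 + x 1 ^ 2) ≠ 0 := by positivity
  have hc : ∀ i : Fin 3, HasFDerivAt (fun y : Fin 3 → ℝ => y i)
      (ContinuousLinearMap.proj (R := ℝ) (φ := fun _ : Fin 3 => ℝ) i) x :=
    fun i => hasFDerivAt_apply i x
  have hs := ((hc 0).pow 2).add ((hc 1).pow 2)
  have hd := hs.const_add 1
  have hi : HasFDerivAt (fun y : Fin 3 → ℝ => (1 + (y 0 ^ 2 + y 1 ^ 2))⁻¹) _ x :=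
    (hasDerivAt_inv h0).comp_hasFDerivAt x hd
  rw [hasFDerivAt_pi']
  intro i
  fin_cases i
  · refine (((hc 2).mul ((hc 0).const_mul 2)).mul hi).congr_fderiv ?_
    ext y
    simp [stereoPolarJacobian, dotProduct, Fin.sum_univ_three]
    field_simp
    ring
  · refine (((hc 2).mul ((hc 1).const_mul 2)).mul hi).congr_fderiv ?_
    ext y
    simp [stereoPolarJacobian, dotProduct, Fin.sum_univ_three]
    field_simp
    ring
  · refine (((hc 2).mul (hs.sub_const 1)).mul hi).congr_fderiv ?_
    ext y
    simp [stereoPolarJacobian, dotProduct, Fin.sum_univ_three]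
    field_simp
    ring

/-- The norm of the image recovers the radius `x 2`; projection from the north pole then recovers
the direction. -/
lemma injOn_stereoPolar : Set.InjOn stereoPolar {x | 0 < x 2} := by
  have key : ∀ x : Fin 3 → ℝ, 0 < x 2 →
      (stereoPolar x 0 ^ 2 + stereoPolar x 1 ^ 2 + stereoPolar x 2 ^ 2 = x 2 ^ 2) ∧
      x 2 - stereoPolar x 2 ≠ 0 ∧
      x 0 * (x 2 - stereoPolar x 2) = stereoPolar x 0 ∧
      x 1 * (x 2 - stereoPolar x 2) = stereoPolar x 1 := by
    intro x hx
    have h0 : 1 + (x 0 ^ 2 + x 1 ^ 2) ≠ 0 := by positivity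
    have h2 : x 2 - stereoPolar x 2 = 2 * x 2 / (1 + (x 0 ^ 2 + x 1 ^ 2)) := by
      simp only [stereoPolar, Matrix.cons_val]
      field_simp
      ring
    refine ⟨?_, ?_, ?_, ?_⟩
    · simp only [stereoPolar, Matrix.cons_val]
      field_simp
      ring
    · rw [h2]
      positivity
    · rw [h2]
      simp only [stereoPolar, Matrix.cons_val]
      field_simp
    · rw [h2]
      simp only [stereoPolar, Matrix.cons_val]
      field_simp
  intro x hx y hy hxy
  obtain ⟨h1, h2, h3, h4⟩ := key x hx
  obtain ⟨k1, k2, k3, k4⟩ := key y hy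
  have hr : x 2 = y 2 := by
    rw [hxy, k1] at h1
    exact ((pow_left_inj₀ (le_of_lt hx) (le_of_lt hy) two_ne_zero).1 h1.symm)
  rw [hxy, hr] at h3 h4
  ext i
  fin_cases i
  · exact mul_right_cancel₀ k2 (h3.trans k3.symm)
  · exact mul_right_cancel₀ k2 (h4.trans k4.symm)
  · exact hr

/-- The height-and-base coordinates `x ↦ (x₂, x₀ + i x₁)` on `ℝ³`. -/
def heightBase (x : Fin 3 → ℝ) : ℝ × ℂ := (x 2, ⟨x 0, x 1⟩)

lemma measurePreserving_heightBase : MeasurePreserving heightBase := by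
  have h := ((MeasurePreserving.id volume).prod
    (Complex.volume_preserving_equiv_pi.symm Complex.measurableEquivPi)).comp
    (volume_preserving_piFinSuccAbove (fun _ : Fin 3 => ℝ) 2)
  have e : heightBase = Prod.map id Complex.measurableEquivPi.symm ∘
      MeasurableEquiv.piFinSuccAbove (fun _ : Fin 3 => ℝ) 2 := by
    ext x
    · rfl
    · simp [heightBase, Complex.measurableEquivPi_symm_apply, Fin.removeNth, Fin.succAbove,
        Complex.mk_eq_add_mul_I]
  rw [e]
  exact h

lemma smul_toRiemannSphere (r : ℝ) (z : ℂ) :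
    r • (toRiemannSphere z : EuclideanSpace ℝ (Fin 3)) =
      WithLp.toLp 2 (stereoPolar ![z.re, z.im, r]) := by
  have h : ‖z‖ ^ 2 = z.re ^ 2 + z.im ^ 2 := by
    rw [Complex.sq_norm, Complex.normSq_apply]; ring
  ext i
  fin_cases i <;> simp [toRiemannSphere, stereoPolar, h, mul_div_assoc]

/-- The condition `t.1 0 ≠ 0` is a convenient way to avoid the north pole: what it excludes spans a
null hyperplane. -/
lemma exists_toRiemannSphere_eq (t : RiemannSphere) (ht : t.1 0 ≠ 0) :
    ∃ z, toRiemannSphere z = t := by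
  obtain ⟨t, hts⟩ := t
  rw [mem_sphere_zero_iff_norm, EuclideanSpace.norm_eq, Real.sqrt_eq_one] at hts
  simp only [Fin.sum_univ_three, Real.norm_eq_abs, sq_abs] at hts
  simp only at ht
  have h1 : 1 - t 2 ≠ 0 := by
    intro h
    have : t 2 = 1 := by linarith
    rw [this] at hts
    have h0 : 0 < t 0 ^ 2 := by positivity
    nlinarith [sq_nonneg (t 1)]
  have hn : t 0 ^ 2 + t 1 ^ 2 = (1 - t 2) * (1 + t 2) := by linarith
  refine ⟨⟨t 0 / (1 - t 2), t 1 / (1 - t 2)⟩, ?_⟩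
  have h : ‖(⟨t 0 / (1 - t 2), t 1 / (1 - t 2)⟩ : ℂ)‖ ^ 2 = (1 + t 2) / (1 - t 2) := by
    rw [Complex.sq_norm, Complex.normSq_mk]
    field_simp
    linarith
  have h2 : 1 + (1 + t 2) / (1 - t 2) = 2 / (1 - t 2) := by
    field_simp
    ring
  ext i
  fin_cases i
  all_goals
    simp only [toRiemannSphere, h, h2]
    simp
    field_simp
    try ring

lemma lintegral_Ioo_sq : ∫⁻ r in Set.Ioo (0 : ℝ) 1, ENNReal.ofReal (r ^ 2) =
    ENNReal.ofReal (1 / 3) := by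
  rw [← ofReal_integral_eq_lintegral_ofReal, ← integral_Ioc_eq_integral_Ioo,
    ← intervalIntegral.integral_of_le zero_le_one]
  · congr 1
    simp
    norm_num
  · exact (Continuous.integrableOn_Icc (by fun_prop)).mono_set Set.Ioo_subset_Icc_self
  · exact Filter.Eventually.of_forall fun r => sq_nonneg r

-- Up to a null set, the cone over `T` is the image under `stereoPolar` of the region with radius in
-- `(0, 1)` and base in the preimage of `T`. The Jacobian splits as `r²`, of integral `1/3`, times
-- `4/(1 + |z|²)²`, which is `4π` times the spherical density.
open scoped Pointwise in
lemma volume_Ioo_smul {T : Set RiemannSphere} (hT : MeasurableSet (toRiemannSphere ⁻¹' T)) :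
    (volume : Measure (EuclideanSpace ℝ (Fin 3))) (Set.Ioo (0 : ℝ) 1 • ((↑) '' T)) =
      ENNReal.ofReal (4 * Real.pi / 3) * sphericalMeasure (toRiemannSphere ⁻¹' T) := by
  set S := toRiemannSphere ⁻¹' T with hS
  set U := heightBase ⁻¹' (Set.Ioo (0 : ℝ) 1 ×ˢ S) with hU
  have hUm : MeasurableSet U := measurePreserving_heightBase.measurable (measurableSet_Ioo.prod hT)
  have h1 : WithLp.toLp 2 ⁻¹' (Set.Ioo (0 : ℝ) 1 • ((↑) '' T : Set (EuclideanSpace ℝ (Fin 3))))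
      =ᵐ[volume] stereoPolar '' U := by
    have hnull : ∀ᵐ v : Fin 3 → ℝ, v 0 ≠ 0 :=
      measure_eq_zero_iff_ae_notMem.1 (Measure.pi_hyperplane _ 0 0)
    rw [Filter.eventuallyEq_set]
    filter_upwards [hnull] with v hv
    constructor
    · rintro ⟨r, hr, _, ⟨t, ht, rfl⟩, h⟩
      have ht0 : t.1 0 ≠ 0 := by
        intro h0
        apply hv
        have := congrArg (fun w : EuclideanSpace ℝ (Fin 3) => w 0) h
        simpa [h0] using this.symm
      obtain ⟨z, rfl⟩ := exists_toRiemannSphere_eq t ht0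
      refine ⟨![z.re, z.im, r], ⟨hr, ht⟩, ?_⟩
      have h' : r • (toRiemannSphere z : EuclideanSpace ℝ (Fin 3)) = WithLp.toLp 2 v := h
      rw [smul_toRiemannSphere] at h'
      exact congrArg WithLp.ofLp h'
    · rintro ⟨x, ⟨hr, hx⟩, rfl⟩
      refine ⟨x 2, hr, _, ⟨_, hx, rfl⟩, ?_⟩
      change x 2 • (toRiemannSphere ⟨x 0, x 1⟩ : EuclideanSpace ℝ (Fin 3)) = _
      rw [smul_toRiemannSphere]
      congr 2
      ext i
      fin_cases i <;> rfl
  rw [← (PiLp.volume_preserving_toLp (Fin 3)).measure_preimage_equiv (f := MeasurableEquiv.toLp 2 _)]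
  change volume (WithLp.toLp 2 ⁻¹' _) = _
  rw [measure_congr h1,
    ← lintegral_abs_det_fderiv_eq_addHaar_image volume hUm
      (fun x _ => (hasFDerivAt_stereoPolar x).hasFDerivWithinAt)
      (injOn_stereoPolar.mono fun x hx => hx.1.1)]
  have h2 : ∀ x, ENNReal.ofReal
      |(LinearMap.toContinuousLinearMap (Matrix.toLin' (stereoPolarJacobian x))).det| =
      ENNReal.ofReal ((heightBase x).1 ^ 2) *
        ENNReal.ofReal (4 / (1 + ‖(heightBase x).2‖ ^ 2) ^ 2) := by
    intro x
    rw [ContinuousLinearMap.det, LinearMap.coe_toContinuousLinearMap, LinearMap.det_toLin',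
      det_stereoPolarJacobian, abs_neg, abs_of_nonneg (by positivity),
      ← ENNReal.ofReal_mul (by positivity), Complex.sq_norm]
    simp only [heightBase, Complex.normSq_mk]
    congr 1
    ring
  simp_rw [h2]
  rw [hU, measurePreserving_heightBase.setLIntegral_comp_preimage (measurableSet_Ioo.prod hT)
    (f := fun p : ℝ × ℂ => ENNReal.ofReal (p.1 ^ 2) * ENNReal.ofReal (4 / (1 + ‖p.2‖ ^ 2) ^ 2))
    (by fun_prop), Measure.volume_eq_prod, ← Measure.prod_restrict,
    lintegral_prod_mul (f := fun r : ℝ => ENNReal.ofReal (r ^ 2))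
      (g := fun z : ℂ => ENNReal.ofReal (4 / (1 + ‖z‖ ^ 2) ^ 2)) (by fun_prop) (by fun_prop),
    lintegral_Ioo_sq, sphericalMeasure,
    withDensity_apply _ hT, ← lintegral_const_mul _ (by fun_prop),
    ← lintegral_const_mul _ (by fun_prop)]
  refine lintegral_congr fun z => ?_
  rw [← ENNReal.ofReal_mul (by positivity), ← ENNReal.ofReal_mul (by positivity)]
  congr 1
  field_simp

lemma measurable_toRiemannSphere : Measurable toRiemannSphere := by
  refine Measurable.subtype_mk ?_
  refine (MeasurableEquiv.toLp 2 (Fin 3 → ℝ)).measurable.comp (measurable_pi_lambda _ fun i => ?_)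
  fin_cases i <;> simp <;> fun_prop

lemma map_toRiemannSphere_sphericalMeasure :
    sphericalMeasure.map toRiemannSphere = uniformRiemannSphere := by
  have key : ∀ T, MeasurableSet T →
      (volume : Measure (EuclideanSpace ℝ (Fin 3))).toSphere T =
        ENNReal.ofReal (4 * Real.pi) * sphericalMeasure (toRiemannSphere ⁻¹' T) := by
    intro T hT
    rw [Measure.toSphere_apply' _ hT, volume_Ioo_smul (measurable_toRiemannSphere hT), ← mul_assoc,
      finrank_euclideanSpace_fin, ← ENNReal.ofReal_natCast, ← ENNReal.ofReal_mul (by positivity)]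
    congr 2
    push_cast
    ring
  ext T hT
  rw [uniformRiemannSphere, Measure.smul_apply, smul_eq_mul, key _ hT, key _ MeasurableSet.univ,
    Set.preimage_univ, measure_univ, mul_one, ← mul_assoc, ENNReal.inv_mul_cancel, one_mul,
    Measure.map_apply measurable_toRiemannSphere hT]
  · simp [Real.pi_pos]
  · exact ENNReal.ofReal_ne_top

/-! ### Almost sure invertibility. -/

/-- The Gaussian density is positive and finite, so Lebesgue measure has the reciprocal product
density with respect to the Gaussian product; as this never vanishes, null sets transfer back. -/
lemma pi_gaussian_absolutelyContinuous {ι : Type*} [Fintype ι] :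
    Measure.pi (fun _ : ι => stdComplexGaussian) ≪ (volume : Measure (ι → ℂ)) := by
  set g : ℂ → ℝ≥0∞ := fun z => ENNReal.ofReal (Real.exp (-‖z‖ ^ 2) / Real.pi) with hg
  have hgm : Measurable g := by fun_prop
  have hvol : (volume : Measure ℂ) = stdComplexGaussian.withDensity g⁻¹ :=
    (withDensity_inv_same hgm (Filter.Eventually.of_forall fun z => by simp [hg]; positivity)
      (Filter.Eventually.of_forall fun z => ENNReal.ofReal_ne_top)).symm
  have hpi : (volume : Measure (ι → ℂ)) =
      (Measure.pi fun _ : ι => stdComplexGaussian).withDensity fun x => ∏ i, (g (x i))⁻¹ := by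
    refine Measure.pi_eq fun s hs => ?_
    rw [withDensity_apply _ (MeasurableSet.univ_pi hs),
      ← lintegral_indicator (MeasurableSet.univ_pi hs)]
    have h1 : ∀ x : ι → ℂ, (Set.univ.pi s).indicator (fun x => ∏ i, (g (x i))⁻¹) x =
        ∏ i, (s i).indicator g⁻¹ (x i) := by
      intro x
      by_cases hx : x ∈ Set.univ.pi s
      · rw [Set.indicator_of_mem hx]
        exact Finset.prod_congr rfl fun i _ => by
          rw [Set.indicator_of_mem (hx i (Set.mem_univ i)), Pi.inv_apply]
      · rw [Set.indicator_of_notMem hx]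
        simp only [Set.mem_univ_pi, not_forall] at hx
        obtain ⟨i, hi⟩ := hx
        exact (Finset.prod_eq_zero (Finset.mem_univ i) (Set.indicator_of_notMem hi _)).symm
    have hm : ∀ i, Measurable ((s i).indicator g⁻¹) := fun i => hgm.inv.indicator (hs i)
    simp_rw [h1]
    rw [lintegral_prod_eq_prod_lintegral_of_indepFun Finset.univ
      (fun i (x : ι → ℂ) => (s i).indicator g⁻¹ (x i))
      (iIndepFun_pi fun i => (hm i).aemeasurable) (fun i => (hm i).comp (measurable_pi_apply i))]
    refine Finset.prod_congr rfl fun i _ => ?_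
    rw [(measurePreserving_eval (fun _ : ι => stdComplexGaussian) i).lintegral_comp (hm i),
      lintegral_indicator (hs i), ← withDensity_apply _ (hs i), ← hvol]
  rw [hpi]
  refine withDensity_absolutelyContinuous' (Finset.measurable_prod _ fun i _ =>
    (hgm.comp (measurable_pi_apply i)).inv).aemeasurable (Filter.Eventually.of_forall fun x => ?_)
  exact Finset.prod_ne_zero_iff.2 fun i _ => ENNReal.inv_ne_zero.2 ENNReal.ofReal_ne_top

/-- On each line `w + t • 1` the determinant is a characteristic polynomial in `t`, with finitely
many zeros. Fubini yields one `t` that works for almost every `w`, and translation invariance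
removes it. -/
lemma ae_det_ne_zero {n : Type*} [Fintype n] [DecidableEq n] :
    ∀ᵐ w : n × n → ℂ, (Matrix.of fun i j => w (i, j)).det ≠ 0 := by
  let e : n × n → ℂ := fun p => (1 : Matrix n n ℂ) p.1 p.2
  have hdet : ∀ (w : n × n → ℂ) (t : ℂ), (Matrix.of fun i j => (w + t • e) (i, j)).det =
      (-(Matrix.of fun i j => w (i, j))).charpoly.eval t := by
    intro w t
    rw [Matrix.eval_charpoly]
    congr 1
    ext i j
    simp [e, Matrix.one_apply, Matrix.diagonal_apply, add_comm]
  have hfin : ∀ w : n × n → ℂ, ∀ᵐ t : ℂ, (Matrix.of fun i j => (w + t • e) (i, j)).det ≠ 0 := by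
    intro w
    have h : {t : ℂ | (-(Matrix.of fun i j => w (i, j))).charpoly.IsRoot t}.Finite :=
      Polynomial.finite_setOfPred_isRoot (Matrix.charpoly_monic _).ne_zero
    filter_upwards [measure_eq_zero_iff_ae_notMem.1 (h.measure_zero volume)] with t ht
    rwa [hdet]
  have hcont : Continuous fun q : (n × n → ℂ) × ℂ =>
      (Matrix.of fun i j => (q.1 + q.2 • e) (i, j)).det := by
    refine Continuous.matrix_det (continuous_matrix fun i j => ?_)
    simp only [Matrix.of_apply, Pi.add_apply, Pi.smul_apply]
    fun_prop
  have hset : MeasurableSet {q : (n × n → ℂ) × ℂ |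
      (Matrix.of fun i j => (q.1 + q.2 • e) (i, j)).det ≠ 0} :=
    hcont.measurable (measurableSet_singleton 0).compl
  have hswap : ∀ᵐ t : ℂ, ∀ᵐ w : n × n → ℂ, (Matrix.of fun i j => (w + t • e) (i, j)).det ≠ 0 :=
    (Measure.ae_ae_comm hset).1
      (Filter.Eventually.of_forall hfin)
  obtain ⟨t, ht⟩ := hswap.exists
  filter_upwards [(measurePreserving_sub_right volume (t • e)).quasiMeasurePreserving.ae ht]
    with w hw
  simpa using hw

lemma lintegral_multiset_sum {α β : Type*} [MeasurableSpace α] (μ : Measure α) (s : Multiset β)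
    {f : β → α → ℝ≥0∞} (hf : ∀ b, Measurable (f b)) :
    ∫⁻ x, (s.map fun b => f b x).sum ∂μ = (s.map fun b => ∫⁻ x, f b x ∂μ).sum := by
  induction s using Multiset.induction with
  | empty => simp
  | cons b s ih =>
    simp only [Multiset.map_cons, Multiset.sum_cons]
    rw [lintegral_add_left (hf b), ih]

/-! ### Invariance of the matrix pair and averaging over rotations. -/

variable {N : ℕ}

/-- The first matrix of a pair of matrices given entrywise. -/
def fstMatrix (w : Fin N × Fin N → ℂ × ℂ) : Matrix (Fin N) (Fin N) ℂ :=
  Matrix.of fun i j => (w (i, j)).1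

/-- The second matrix of a pair of matrices given entrywise. -/
def sndMatrix (w : Fin N × Fin N → ℂ × ℂ) : Matrix (Fin N) (Fin N) ℂ :=
  Matrix.of fun i j => (w (i, j)).2

/-- The law of a pair of independent standard complex Gaussian matrices. -/
noncomputable def pairLaw (N : ℕ) : Measure (Fin N × Fin N → ℂ × ℂ) :=
  Measure.pi fun _ => stdComplexGaussian.prod stdComplexGaussian

instance : IsProbabilityMeasure (pairLaw N) := by
  unfold pairLaw
  infer_instance

/-- The spectral measure of the quotient of a pair of matrices. -/
noncomputable def quotientSpectrum (w : Fin N × Fin N → ℂ × ℂ) : Measure ℂ :=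
  spectralMeasure (fstMatrix w * (sndMatrix w)⁻¹)

lemma measurable_quotientSpectrum : Measurable (quotientSpectrum (N := N)) := by
  have hc : Continuous (sndMatrix (N := N)) := continuous_matrix fun i j => by
    simp only [sndMatrix, Matrix.of_apply]
    fun_prop
  have hm : Measurable fun (w : Fin N × Fin N → ℂ × ℂ) (p : Fin N × Fin N) =>
      (fstMatrix w * (sndMatrix w)⁻¹) p.1 p.2 := by
    refine measurable_pi_lambda _ fun p => ?_
    -- The formula adjugate over determinant, with `0⁻¹ = 0`, is measurable everywhere, singular
    -- matrices included.
    simp only [Matrix.mul_apply, Matrix.inv_def, Matrix.smul_apply, Ring.inverse_eq_inv',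
      smul_eq_mul, fstMatrix, Matrix.of_apply]
    refine Finset.measurable_sum _ fun k _ => Measurable.mul (by fun_prop) (Measurable.mul ?_ ?_)
    · exact hc.matrix_det.measurable.inv
    · exact (hc.matrix_adjugate.matrix_elem k p.2).measurable
  have e : quotientSpectrum (N := N) = (fun v : Fin N × Fin N → ℂ =>
      spectralMeasure (Matrix.of fun i j => v (i, j))) ∘
      fun w p => (fstMatrix w * (sndMatrix w)⁻¹) p.1 p.2 := rfl
  rw [e]
  exact measurable_spectralMeasure.comp hm

/-- The entrywise action of `unitaryMap` on pairs of matrices. -/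
noncomputable def act (p : ℂ × ℂ) (w : Fin N × Fin N → ℂ × ℂ) : Fin N × Fin N → ℂ × ℂ :=
  fun ij => unitaryMap p.1 p.2 (w ij)

lemma measurable_act : Measurable fun q : (ℂ × ℂ) × (Fin N × Fin N → ℂ × ℂ) => act q.1 q.2 := by
  refine measurable_pi_lambda _ fun ij => ?_
  simp only [act, unitaryMap, LinearMap.coe_mk, AddHom.coe_mk]
  have : Measurable (starRingEnd ℂ : ℂ → ℂ) := Complex.continuous_conj.measurable
  fun_prop

lemma quotientSpectrum_smul {c : ℝ} (hc : c ≠ 0) (w : Fin N × Fin N → ℂ × ℂ) :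
    quotientSpectrum (c • w) = quotientSpectrum w := by
  have hc' : (c : ℂ) ≠ 0 := Complex.ofReal_ne_zero.2 hc
  have h1 : fstMatrix (c • w) = (c : ℂ) • fstMatrix w := by ext i j; simp [fstMatrix]
  have h2 : sndMatrix (c • w) = (c : ℂ) • sndMatrix w := by ext i j; simp [sndMatrix]
  unfold quotientSpectrum
  congr 1
  rw [h1, h2]
  by_cases h : IsUnit (sndMatrix w).det
  · have := Matrix.inv_smul' (sndMatrix w) (Units.mk0 _ hc') h
    rw [Units.smul_def, Units.val_mk0] at this
    rw [this, Units.smul_def, Units.val_inv_eq_inv_val, Units.val_mk0, Matrix.smul_mul,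
      Matrix.mul_smul, smul_smul, mul_inv_cancel₀ hc', one_smul]
  -- In the singular case both inverses are `0` by convention.
  · rw [Matrix.nonsing_inv_apply_not_isUnit _ h, Matrix.nonsing_inv_apply_not_isUnit]
    · simp
    · rw [Matrix.det_smul]
      simpa [hc', isUnit_iff_ne_zero] using h

lemma lintegral_quotientSpectrum_act {p : ℂ × ℂ} (hp : 0 < ‖p.1‖ ^ 2 + ‖p.2‖ ^ 2) {S : Set ℂ}
    (hS : MeasurableSet S) :
    ∫⁻ w : Fin N × Fin N → ℂ × ℂ, quotientSpectrum (act p w) S ∂pairLaw N =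
      ∫⁻ w, quotientSpectrum w S ∂pairLaw N := by
  have h := measurePreserving_inv_smul _ hp (unitaryMap_norm p.1 p.2)
  have h' := measurePreserving_pi (ι := Fin N × Fin N)
    (fun _ => stdComplexGaussian.prod stdComplexGaussian)
    (fun _ => stdComplexGaussian.prod stdComplexGaussian) fun _ => h
  have hm : Measurable fun w : Fin N × Fin N → ℂ × ℂ => quotientSpectrum w S :=
    (Measure.measurable_coe hS).comp measurable_quotientSpectrum
  unfold pairLaw
  rw [← h'.lintegral_comp hm]
  refine lintegral_congr fun w => ?_
  have : (fun i => ((Real.sqrt (‖p.1‖ ^ 2 + ‖p.2‖ ^ 2))⁻¹ • unitaryMap p.1 p.2) (w i)) =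
      (Real.sqrt (‖p.1‖ ^ 2 + ‖p.2‖ ^ 2))⁻¹ • act p w := rfl
  rw [this, quotientSpectrum_smul (inv_ne_zero (Real.sqrt_pos.2 hp).ne')]

/-- With `A = XB`, both mixed matrices have `B` as a right factor, which cancels in the quotient and
leaves a Möbius transform of `X`. -/
lemma quotientSpectrum_act_apply {w : Fin N × Fin N → ℂ × ℂ} (hw : IsUnit (sndMatrix w))
    {p : ℂ × ℂ}
    (hp : ∀ z ∈ (fstMatrix w * (sndMatrix w)⁻¹).charpoly.roots, (coeffMap z p).2 ≠ 0)
    {S : Set ℂ} (hS : MeasurableSet S) :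
    quotientSpectrum (act p w) S = (N : ℝ≥0∞)⁻¹ *
      ((fstMatrix w * (sndMatrix w)⁻¹).charpoly.roots.map fun z =>
        S.indicator 1 ((coeffMap z p).1 / (coeffMap z p).2)).sum := by
  have hdet := (Matrix.isUnit_iff_isUnit_det _).1 hw
  set X := fstMatrix w * (sndMatrix w)⁻¹ with hX
  have hXB : X * sndMatrix w = fstMatrix w := Matrix.nonsing_inv_mul_cancel_right _ _ hdet
  have h1 : fstMatrix (act p w) = (p.1 • X + p.2 • 1) * sndMatrix w := by
    rw [add_mul, smul_mul_assoc, smul_mul_assoc, one_mul, hXB]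
    ext i j
    simp [fstMatrix, sndMatrix, act, unitaryMap]
  have h2 : sndMatrix (act p w) =
      ((-(starRingEnd ℂ p.2)) • X + starRingEnd ℂ p.1 • 1) * sndMatrix w := by
    rw [add_mul, smul_mul_assoc, smul_mul_assoc, one_mul, hXB]
    ext i j
    simp [fstMatrix, sndMatrix, act, unitaryMap]
  rw [quotientSpectrum, spectralMeasure_apply _ hS, h1, h2, Matrix.mul_inv_rev, ← mul_assoc,
    Matrix.mul_nonsing_inv_cancel_right _ _ hdet, roots_charpoly_moebius _ _ _ _ _ hp,
    Multiset.map_map]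
  rfl

lemma lintegral_gaussian_quotientSpectrum_act (hN : N ≠ 0) {w : Fin N × Fin N → ℂ × ℂ}
    (hw : IsUnit (sndMatrix w)) {S : Set ℂ} (hS : MeasurableSet S) :
    ∫⁻ p, quotientSpectrum (act p w) S ∂(stdComplexGaussian.prod stdComplexGaussian) =
      sphericalMeasure S := by
  set X := fstMatrix w * (sndMatrix w)⁻¹ with hX
  have hae : ∀ᵐ p ∂stdComplexGaussian.prod stdComplexGaussian,
      ∀ z ∈ X.charpoly.roots, (coeffMap z p).2 ≠ 0 := by
    have := (ae_ball_iff X.charpoly.roots.toFinset.countable_toSet).2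
      fun z _ => ae_coeffMap_snd_ne_zero z
    filter_upwards [this] with p hp z hz
    exact hp z (by simpa using hz)
  have hm : ∀ z, Measurable fun p => (coeffMap z p).1 / (coeffMap z p).2 := fun z => by
    have : Measurable (coeffMap z) := (coeffMap z).continuous_of_finiteDimensional.measurable
    fun_prop
  have hmi : ∀ z, Measurable fun p => S.indicator (1 : ℂ → ℝ≥0∞)
      ((coeffMap z p).1 / (coeffMap z p).2) := fun z =>
    (measurable_one.indicator hS).comp (hm z)
  rw [lintegral_congr_ae (hae.mono fun p hp => quotientSpectrum_act_apply hw hp hS),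
    lintegral_const_mul' _ _ (by simpa using hN), lintegral_multiset_sum _ _ hmi]
  have hone : ∀ z, ∫⁻ p, S.indicator (1 : ℂ → ℝ≥0∞) ((coeffMap z p).1 / (coeffMap z p).2)
      ∂(stdComplexGaussian.prod stdComplexGaussian) = sphericalMeasure S := by
    intro z
    rw [← lintegral_map (measurable_one.indicator hS) (hm z), map_moebius_gaussian_prod,
      lintegral_indicator_one hS]
  simp_rw [hone]
  rw [Multiset.map_const', Multiset.sum_replicate, card_roots_charpoly, nsmul_eq_mul, ← mul_assoc,
    ENNReal.inv_mul_cancel (by simpa using hN) (by simp), one_mul]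

lemma measurePreserving_snd_pairLaw :
    MeasurePreserving (fun (w : Fin N × Fin N → ℂ × ℂ) ij => (w ij).2) (pairLaw N)
      (Measure.pi fun _ => stdComplexGaussian) :=
  measurePreserving_pi _ _ fun _ => measurePreserving_snd

lemma ae_isUnit_sndMatrix : ∀ᵐ w ∂pairLaw N, IsUnit (sndMatrix w) := by
  filter_upwards [measurePreserving_snd_pairLaw.quasiMeasurePreserving.ae
    (pi_gaussian_absolutelyContinuous.ae_le ae_det_ne_zero)] with w hw
  exact (Matrix.isUnit_iff_isUnit_det _).2 (isUnit_iff_ne_zero.2 hw)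

/-- Averaging over an extra random rotation changes nothing, by invariance; carried out first, for a
fixed pair, it already gives the spherical measure. -/
lemma lintegral_quotientSpectrum (hN : N ≠ 0) {S : Set ℂ} (hS : MeasurableSet S) :
    ∫⁻ w, quotientSpectrum w S ∂pairLaw N = sphericalMeasure S := by
  have hm : Measurable fun q : (ℂ × ℂ) × (Fin N × Fin N → ℂ × ℂ) =>
      quotientSpectrum (act q.1 q.2) S :=
    (Measure.measurable_coe hS).comp (measurable_quotientSpectrum.comp measurable_act)
  calc ∫⁻ w, quotientSpectrum w S ∂pairLaw N
      = ∫⁻ _, ∫⁻ w, quotientSpectrum w S ∂pairLaw N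
          ∂(stdComplexGaussian.prod stdComplexGaussian) := by simp
    _ = ∫⁻ p, ∫⁻ w, quotientSpectrum (act p w) S ∂pairLaw N
          ∂(stdComplexGaussian.prod stdComplexGaussian) :=
        lintegral_congr_ae (ae_ne_zero_gaussian_prod.mono fun p hp =>
          (lintegral_quotientSpectrum_act hp hS).symm)
    _ = ∫⁻ w, ∫⁻ p, quotientSpectrum (act p w) S
          ∂(stdComplexGaussian.prod stdComplexGaussian) ∂pairLaw N :=
        lintegral_lintegral_swap hm.aemeasurable
    _ = ∫⁻ _, sphericalMeasure S ∂pairLaw N :=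
        lintegral_congr_ae (ae_isUnit_sndMatrix.mono fun w hw =>
          lintegral_gaussian_quotientSpectrum_act hN hw hS)
    _ = sphericalMeasure S := by simp

/-- Joint independence gives a product law over the `2N²` entries, regrouped here into `N²` pairs so
that the mixing acts on each factor separately. -/
lemma AreIndepStdComplexGaussianMatrices.hasLaw_pair {Ω : Type*} [MeasurableSpace Ω]
    {P : Measure Ω} [IsProbabilityMeasure P] {A B : Ω → Matrix (Fin N) (Fin N) ℂ}
    (h : AreIndepStdComplexGaussianMatrices A B P) :
    HasLaw (fun ω (p : Fin N × Fin N) => (A ω p.1 p.2, B ω p.1 p.2)) (pairLaw N) P := by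
  set f := Sum.elim (fun (p : Fin N × Fin N) ω => A ω p.1 p.2)
    (fun (p : Fin N × Fin N) ω => B ω p.1 p.2) with hf
  have hlaw : ∀ i, HasLaw (f i) stdComplexGaussian P := by
    rintro (p | p)
    · exact h.hasLaw_left p.1 p.2
    · exact h.hasLaw_right p.1 p.2
  have hmap := (iIndepFun_iff_map_fun_eq_pi_map fun i => (hlaw i).aemeasurable).1 h.indep
  simp_rw [(hlaw _).map_eq] at hmap
  have hfm : AEMeasurable (fun ω i => f i ω) P :=
    aemeasurable_pi_lambda _ fun i => (hlaw i).aemeasurable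
  have hmp := ((measurePreserving_arrowProdEquivProdArrow ℂ ℂ (Fin N × Fin N)
    (fun _ => stdComplexGaussian) fun _ => stdComplexGaussian).symm _).comp
    (measurePreserving_sumPiEquivProdPi fun _ : Fin N × Fin N ⊕ Fin N × Fin N => stdComplexGaussian)
  refine ⟨hmp.measurable.comp_aemeasurable hfm, ?_⟩
  have := AEMeasurable.map_map_of_aemeasurable hmp.measurable.aemeasurable hfm
  rw [hmap, hmp.map_eq] at this
  exact this.symm

end SphericalEnsemble

theorem mainTheorem2 {Ω : Type*} [MeasurableSpace Ω] (P : Measure Ω) [IsProbabilityMeasure P]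
    (N : ℕ) (hN : 1 ≤ N) (A B : Ω → Matrix (Fin N) (Fin N) ℂ)
    (hAB : SphericalEnsemble.AreIndepStdComplexGaussianMatrices A B P) :
    (∀ᵐ ω ∂P, IsUnit (B ω)) ∧
    AEMeasurable (fun ω => SphericalEnsemble.spectralMeasure (A ω * (B ω)⁻¹)) P ∧
    SphericalEnsemble.meanSpectralMeasure (fun ω => A ω * (B ω)⁻¹) P =
      volume.withDensity
        (fun z : ℂ => ENNReal.ofReal (1 / (Real.pi * (1 + ‖z‖ ^ 2) ^ 2))) ∧
    (SphericalEnsemble.meanSpectralMeasure (fun ω => A ω * (B ω)⁻¹) P).map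
      SphericalEnsemble.toRiemannSphere = SphericalEnsemble.uniformRiemannSphere := by
  have hlaw := hAB.hasLaw_pair
  have hq : (fun ω => SphericalEnsemble.spectralMeasure (A ω * (B ω)⁻¹)) =
      SphericalEnsemble.quotientSpectrum ∘
        fun ω (p : Fin N × Fin N) => (A ω p.1 p.2, B ω p.1 p.2) := by
    ext1 ω
    have hA : SphericalEnsemble.fstMatrix (fun p : Fin N × Fin N => (A ω p.1 p.2, B ω p.1 p.2)) =
      A ω := rfl
    have hB : SphericalEnsemble.sndMatrix (fun p : Fin N × Fin N => (A ω p.1 p.2, B ω p.1 p.2)) =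
      B ω := rfl
    rw [Function.comp_apply, SphericalEnsemble.quotientSpectrum, hA, hB]
  have hm : AEMeasurable (fun ω => SphericalEnsemble.spectralMeasure (A ω * (B ω)⁻¹)) P := by
    rw [hq]
    exact SphericalEnsemble.measurable_quotientSpectrum.comp_aemeasurable hlaw.aemeasurable
  have hmean : SphericalEnsemble.meanSpectralMeasure (fun ω => A ω * (B ω)⁻¹) P =
      SphericalEnsemble.sphericalMeasure := by
    ext S hS
    rw [SphericalEnsemble.meanSpectralMeasure, Measure.bind_apply hS hm,
      lintegral_congr fun ω => congrArg (fun μ : Measure ℂ => μ S) (congrFun hq ω),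
      ← SphericalEnsemble.lintegral_quotientSpectrum (Nat.one_le_iff_ne_zero.1 hN) hS,
      ← hlaw.map_eq, lintegral_map' ?_ hlaw.aemeasurable]
    · rfl
    · exact ((Measure.measurable_coe hS).comp
        SphericalEnsemble.measurable_quotientSpectrum).aemeasurable
  refine ⟨?_, hm, hmean, ?_⟩
  · have h := SphericalEnsemble.ae_isUnit_sndMatrix (N := N)
    rw [← hlaw.map_eq] at h
    exact ae_of_ae_map hlaw.aemeasurable h
  · rw [hmean, SphericalEnsemble.map_toRiemannSphere_sphericalMeasure]
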